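/- **Conventions.** Hilbert spaces are complex, of arbitrary dimension. Let $M\subseteq B(H)$ be a von Neumann algebra. A *cp-semigroup* over $\mathbb N^3$ (with $0\in\mathbb N$) on $M$ is a family $\Theta=\{\Theta_n\}_{n\in\mathbb N^3}$ of contractive, normal (ultraweakly continuous), completely positive linear maps $M\to M$ with $\Theta_{m+n}=\Theta_m\circ\Theta_n$ and $\Theta_0=\mathrm{id}$. An *e-semigroup* is a cp-semigroup that consists of (not necessarily unital) $*$-endomorphisms. An *e-dilation* of $\Theta$ is a triple $(\alpha,K,\mathcal R)$, where $K\supseteq H$ is a Hilbert space with orthogonal projection $P_H:K\to H$, $\mathcal R\subseteq B(K)$ is a von Neumann algebra that contains $M$ as the corner $M=P_H\mathcal R P_H$ (an operator on $H$ being extended by $0$ on $K\ominus H$), and $\alpha=\{\alpha_n\}_{n\in\mathbb N^3}$ is an e-semigroup on $\mathcal R$ such that $$\Theta_n(P_H T P_H)=P_H\,\alpha_n(T)\,P_H\qquad (T\in\mathcal R,\ n\in\mathbb N^3).$$ The e-dilation is *minimal* if the central support of $P_H$ in $\mathcal R$ is $I_K$ and $\mathcal R=W^*\bigl(\bigcup_{n}\alpha_n(M)\bigr)$,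 the von Neumann algebra generated by $\bigcup_n\alpha_n(M)$. **Theorem.** There are a Hilbert space $H$ and three commuting contractions $T_1,T_2,T_3\in B(H)$ such that the cp-semigroup $\Theta=\{\Theta_n\}_{n\in\mathbb N^3}$ on $B(H)$ generated by the three commuting completely positive maps $a\mapsto T_i a T_i^*$, that is, $$\Theta_n(a)=T_1^{n_1}T_2^{n_2}T_3^{n_3}\,a\,\bigl(T_1^{n_1}T_2^{n_2}T_3^{n_3}\bigr)^*\qquad (a\in B(H),\ n=(n_1,n_2,n_3)\in\mathbb N^3),$$ has the following two properties. 1. $\Theta$ has no e-dilation of the form $(\alpha,K,B(K))$. (So three commuting contractive normal CP maps on $B(H)$ need not have a simultaneous dilation to three commuting normal $*$-endomorphisms of some $B(K)$, which answers a question of Bhat in the negative.) 2. $\Theta$ has no minimal e-dilation $(\alpha,K,\mathcal R)$ on any von Neumann algebra $\mathcal R$. -/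

import Mathlib

open scoped CStarAlgebra

namespace VonNeumannAlgebra

section Instances

variable {H : Type*} [NormedAddCommGroup H] [InnerProductSpace ℂ H] [CompleteSpace H]

instance instSMulMemClassComplex : SMulMemClass (VonNeumannAlgebra H) ℂ (H →L[ℂ] H) where
  smul_mem {M} c _ ha := M.toStarSubalgebra.smul_mem ha c

theorem isClosed_coe (M : VonNeumannAlgebra H) : IsClosed (M : Set (H →L[ℂ] H)) := by
  rw [← M.centralizer_centralizer]
  exact Set.isClosed_centralizer _

/-- A von Neumann algebra is a C⋆-algebra, with the operations and the norm of `B(H)`. -/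
noncomputable instance instCStarAlgebra (M : VonNeumannAlgebra H) : CStarAlgebra M :=
  StarSubalgebra.cstarAlgebra M (h_closed := M.isClosed_coe)

theorem exists_eq_star_mul_self_of_coe_nonneg (M : VonNeumannAlgebra H) (a : M)
    (ha : 0 ≤ (a : H →L[ℂ] H)) : ∃ s : M, a = star s * s := by
  have hsa : IsSelfAdjoint a := Subtype.ext ha.isSelfAdjoint.star_eq
  have hspec : ∀ x ∈ spectrum ℝ a, 0 ≤ x := by
    intro x hx
    refine spectrum_nonneg_of_nonneg ha ?_
    rw [← spectrum.preimage_algebraMap ℂ, Set.mem_preimage] at hx ⊢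
    have hperm := StarSubalgebra.spectrum_eq (S := M.toStarSubalgebra) (hS := M.isClosed_coe) (a := a)
    exact hperm ▸ hx
  refine ⟨cfc Real.sqrt a, ?_⟩
  rw [(cfc_predicate Real.sqrt a : IsSelfAdjoint _).star_eq, ← cfc_mul Real.sqrt Real.sqrt a]
  conv_lhs => rw [← cfc_id ℝ a]
  exact cfc_congr fun x hx => (Real.mul_self_sqrt (hspec x hx)).symm

/-- The order of `B(H)`, restricted to a von Neumann algebra `M`, is the order of the C⋆-algebra
`M`. -/
instance instStarOrderedRing (M : VonNeumannAlgebra H) : StarOrderedRing M := by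
  refine StarOrderedRing.of_le_iff fun x y => ⟨fun h => ?_, ?_⟩
  · have h0 : (0 : H →L[ℂ] H) ≤ ((y - x : M) : H →L[ℂ] H) := by
      have : (x : H →L[ℂ] H) ≤ y := h
      simpa using sub_nonneg.mpr this
    obtain ⟨s, hs⟩ := M.exists_eq_star_mul_self_of_coe_nonneg (y - x) h0
    exact ⟨s, by rw [← hs]; abel⟩
  · rintro ⟨s, rfl⟩
    change (x : H →L[ℂ] H) ≤ x + star (s : H →L[ℂ] H) * s
    exact le_add_of_nonneg_right (star_mul_self_nonneg _)

end Instances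

section Basic

variable {H : Type*} [NormedAddCommGroup H] [InnerProductSpace ℂ H] [CompleteSpace H]

variable (H) in
/-- The von Neumann algebra `B(H)` of all bounded operators on `H`. -/
noncomputable def allOperators : VonNeumannAlgebra H where
  toStarSubalgebra := ⊤
  centralizer_centralizer' := by
    refine Set.eq_univ_of_forall fun a => ?_
    rw [Set.mem_centralizer_iff]
    intro b hb
    exact (Set.mem_centralizer_iff.mp hb a (Set.mem_univ a)).symm

theorem mem_allOperators (a : H →L[ℂ] H) : a ∈ allOperators H := Set.mem_univ a

/-- The ultraweak (σ-weak) topology of a von Neumann algebra `M ⊆ B(H)`: the coarsest topology for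
which all functionals `a ↦ ∑ₙ ⟪xₙ, a yₙ⟫` with square summable sequences `x`, `y` in `H` are
continuous. -/
@[reducible]
noncomputable def ultraweakTopology (M : VonNeumannAlgebra H) : TopologicalSpace M :=
  ⨅ (x : lp (fun _ : ℕ => H) 2) (y : lp (fun _ : ℕ => H) 2),
    TopologicalSpace.induced (fun a : M => ∑' n, inner ℂ (x n) ((a : H →L[ℂ] H) (y n)))
      inferInstance

/-- A map of a von Neumann algebra into itself is normal if it is ultraweakly continuous. -/
def IsNormalMap (M : VonNeumannAlgebra H) (φ : M → M) : Prop :=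
  @Continuous M M M.ultraweakTopology M.ultraweakTopology φ

/-- `M = W*(A)`: `M` is the smallest von Neumann algebra that contains the set `A`. -/
def IsGeneratedBy (M : VonNeumannAlgebra H) (A : Set (H →L[ℂ] H)) : Prop :=
  IsLeast {N : VonNeumannAlgebra H | A ⊆ N} M

/-- `z` is the central support of `p` in `M`: the smallest projection in the centre `M ∩ M'` of `M`
that dominates `p`. -/
def IsCentralSupport (M : VonNeumannAlgebra H) (p z : H →L[ℂ] H) : Prop :=
  IsLeast {q : H →L[ℂ] H | IsStarProjection q ∧ q ∈ M ∧ q ∈ M.commutant ∧ p ≤ q} z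

end Basic

end VonNeumannAlgebra

section Semigroups

variable {S : Type*} [AddMonoid S]
variable {H : Type*} [NormedAddCommGroup H] [InnerProductSpace ℂ H] [CompleteSpace H]

/-- A cp-semigroup over `S` on the von Neumann algebra `M`: a semigroup of contractive, normal,
completely positive maps (complete positivity is bundled in `M →CP M`). -/
structure IsCPSemigroup {M : VonNeumannAlgebra H} (Θ : S → (M →CP M)) : Prop where
  contractive : ∀ s a, ‖Θ s a‖ ≤ ‖a‖
  normal : ∀ s, M.IsNormalMap (Θ s)
  map_zero : ∀ a, Θ 0 a = a
  map_add : ∀ s t a, Θ (s + t) a = Θ s (Θ t a)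

/-- An e-semigroup: a cp-semigroup that consists of (not necessarily unital) ⋆-endomorphisms. -/
structure IsESemigroup {M : VonNeumannAlgebra H} (α : S → (M →CP M)) : Prop
    extends IsCPSemigroup α where
  map_mul : ∀ s a b, α s (a * b) = α s a * α s b
  map_star : ∀ s a, α s (star a) = star (α s a)

variable {K : Type*} [NormedAddCommGroup K] [InnerProductSpace ℂ K] [CompleteSpace K]

/-- The operator `a` on `H`, regarded as an operator on `K` through the isometric embedding
`J : H → K`: it is `a` on (the image of) `H` and `0` on the orthogonal complement. -/
noncomputable def corner (J : H →ₗᵢ[ℂ] K) (a : H →L[ℂ] H) : K →L[ℂ] K :=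
  J.toContinuousLinearMap ∘L a ∘L ContinuousLinearMap.adjoint J.toContinuousLinearMap

/-- The compression `P_H T|_H` of an operator `T` on `K` to the subspace `H`, embedded by `J`. -/
noncomputable def compress (J : H →ₗᵢ[ℂ] K) (T : K →L[ℂ] K) : H →L[ℂ] H :=
  ContinuousLinearMap.adjoint J.toContinuousLinearMap ∘L T ∘L J.toContinuousLinearMap

/-- `(α, K, R)` is an e-dilation of the cp-semigroup `Θ` on `M ⊆ B(H)`, where `H` is regarded as a
closed subspace of `K` through the isometric embedding `J`. -/
structure IsEDilation {M : VonNeumannAlgebra H} (Θ : S → (M →CP M)) (J : H →ₗᵢ[ℂ] K)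
    (R : VonNeumannAlgebra K) (α : S → (R →CP R)) : Prop where
  isESemigroup : IsESemigroup α
  /-- `R` contains `M`. -/
  corner_mem : ∀ a ∈ M, corner J a ∈ R
  /-- `P_H R P_H` is contained in `M`; so `M = P_H R P_H`. -/
  compress_mem : ∀ T ∈ R, compress J T ∈ M
  /-- `Θ_s (P_H T P_H) = P_H α_s(T) P_H`. -/
  dilation : ∀ (s : S) (T : R),
    (Θ s ⟨compress J T, compress_mem T T.2⟩ : H →L[ℂ] H) = compress J (α s T)

/-- An e-dilation `(α, K, R)` of `Θ` is minimal if the central support in `R` of the projection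
`P_H` of `K` onto `H` is the identity of `K`, and `R = W*(⋃ₛ α_s(M))`. -/
structure IsMinimalEDilation {M : VonNeumannAlgebra H} (Θ : S → (M →CP M)) (J : H →ₗᵢ[ℂ] K)
    (R : VonNeumannAlgebra K) (α : S → (R →CP R)) : Prop extends IsEDilation Θ J R α where
  centralSupport : R.IsCentralSupport (corner J 1) 1
  generated : R.IsGeneratedBy
    {x | ∃ (s : S) (a : M), x = α s ⟨corner J a, corner_mem a a.2⟩}

end Semigroups

/-! Parrott's three commuting contractions on `ℂ⁴` have no commuting isometric dilation. The direct
summand `1` is added to each of them, so that a unit vector `e` is fixed by every `V_s*`. Suppose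
that `α` on `B(K)` dilates `a ↦ V_s a V_s*`. Then `W_s x = α_s(|x⟩⟨Je|) Je` (`intertwiner`) defines
isometries with `W_s W_t = W_{s+t}` and `J* W_s = V_s J*`: multiplicativity of `α` gives the
algebra, and `V_s* e = e` the normalization. Thus a dilation to endomorphisms yields commuting
isometries that dilate the `V_s`, which Parrott's relations exclude (`not_isEDilation_parrott`).

The minimal case reduces to this one: a von Neumann algebra with corner `B(H)` of central support
`1` has scalar commutant, hence is `B(K)` (`eq_allOperators_of_isCentralSupport`). -/

namespace VonNeumannAlgebra

/-! ### Conjugation as a normal completely positive map -/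

section Conjugation

variable {H : Type*} [NormedAddCommGroup H] [InnerProductSpace ℂ H] [CompleteSpace H]

/-- An operator, regarded as an element of the von Neumann algebra `B(H)`. -/
noncomputable def toAllOperators (a : H →L[ℂ] H) : allOperators H := ⟨a, mem_allOperators a⟩

@[simp]
theorem coe_toAllOperators (a : H →L[ℂ] H) : (toAllOperators a : H →L[ℂ] H) = a := rfl

/-- The completely positive map `a ↦ V a V*` on `B(H)`. -/
noncomputable def conjugation (V : H →L[ℂ] H) : allOperators H →CP allOperators H where
  toFun a := toAllOperators V * a * star (toAllOperators V)
  map_add' a b := by rw [mul_add, add_mul]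
  map_smul' c a := by rw [mul_smul_comm, smul_mul_assoc, RingHom.id_apply]
  map_cstarMatrix_nonneg' k M hM := by
    let D : CStarMatrix (Fin k) (Fin k) (allOperators H) :=
      CStarMatrix.ofMatrix (Matrix.diagonal fun _ => toAllOperators V)
    have hD : ∀ i j, D i j = if i = j then toAllOperators V else 0 := fun i j => by
      simp [D, Matrix.diagonal_apply]
    -- Entrywise conjugation by `V` is conjugation by the diagonal matrix `D`, so it preserves
    -- positivity.
    have key : M.map (fun a => toAllOperators V * a * star (toAllOperators V)) = D * M * star D := by
      ext1 i j
      simp [CStarMatrix.mul_apply, CStarMatrix.star_apply, hD, apply_ite star]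
    change 0 ≤ M.map (fun a => toAllOperators V * a * star (toAllOperators V))
    rw [key]
    exact star_right_conjugate_nonneg hM D

@[simp]
theorem coe_conjugation_apply (V : H →L[ℂ] H) (a : allOperators H) :
    (conjugation V a : H →L[ℂ] H) = V * a * star V := rfl

theorem norm_conjugation_apply_le {V : H →L[ℂ] H} (hV : ‖V‖ ≤ 1) (a : allOperators H) :
    ‖conjugation V a‖ ≤ ‖a‖ := by
  change ‖V * (a : H →L[ℂ] H) * star V‖ ≤ ‖(a : H →L[ℂ] H)‖
  calc ‖V * (a : H →L[ℂ] H) * star V‖ ≤ ‖V‖ * ‖(a : H →L[ℂ] H)‖ * ‖star V‖ := norm_mul₃_le ..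
    _ ≤ 1 * ‖(a : H →L[ℂ] H)‖ * 1 := by
        rw [norm_star]; gcongr
    _ = _ := by ring

/-- Moving `V` to the vectors, `⟪x, V a V* y⟫ = ⟪V* x, a V* y⟫`, turns each defining functional into
another one, since `V*` preserves square summability. -/
theorem isNormalMap_conjugation (V : H →L[ℂ] H) :
    (allOperators H).IsNormalMap (conjugation V) := by
  have hmem (x : lp (fun _ : ℕ => H) 2) :
      Memℓp (fun n => ContinuousLinearMap.adjoint V (x n)) 2 := by
    have h := (lp.memℓp x).norm.const_mul ‖ContinuousLinearMap.adjoint V‖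
    refine h.mono fun n => ?_
    simpa using (ContinuousLinearMap.adjoint V).le_opNorm (x n)
  unfold IsNormalMap
  rw [continuous_iInf_rng]
  intro x
  rw [continuous_iInf_rng]
  intro y
  rw [continuous_induced_rng]
  refine (@Continuous.congr _ _ (allOperators H).ultraweakTopology _
    (fun a : allOperators H => ∑' n, inner ℂ ((⟨_, hmem x⟩ : lp (fun _ : ℕ => H) 2) n)
      ((a : H →L[ℂ] H) ((⟨_, hmem y⟩ : lp (fun _ : ℕ => H) 2) n))) _ ?_ fun a => ?_)
  · exact continuous_iInf_dom (i := ⟨_, hmem x⟩)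
      (continuous_iInf_dom (i := ⟨_, hmem y⟩) continuous_induced_dom)
  · refine tsum_congr fun n => ?_
    simp [ContinuousLinearMap.adjoint_inner_left, ContinuousLinearMap.star_eq_adjoint]

end Conjugation

/-! ### Corners `B(H)` of full central support -/

section Factor

variable {H : Type*} [NormedAddCommGroup H] [InnerProductSpace ℂ H]
variable {K : Type*} [NormedAddCommGroup K] [InnerProductSpace ℂ K] [CompleteSpace K]

theorem eq_allOperators_of_commutant_subset_scalars {R : VonNeumannAlgebra K}
    (h : ∀ y ∈ R.commutant, ∃ c : ℂ, y = c • 1) : R = allOperators K := by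
  ext a
  refine ⟨fun _ => mem_allOperators a, fun _ => ?_⟩
  rw [← R.commutant_commutant, mem_commutant_iff]
  intro y hy
  obtain ⟨c, rfl⟩ := h y hy
  simp

/-- The closed linear span of `R J(H)`. -/
noncomputable def cyclicSubspace (R : VonNeumannAlgebra K) (J : H →ₗᵢ[ℂ] K) : Submodule ℂ K :=
  (Submodule.span ℂ {x | ∃ r ∈ R, ∃ h : H, x = r (J h)}).topologicalClosure

instance (R : VonNeumannAlgebra K) (J : H →ₗᵢ[ℂ] K) : CompleteSpace (cyclicSubspace R J) :=
  (Submodule.isClosed_topologicalClosure _).completeSpace_coe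

theorem apply_mem_cyclicSubspace {R : VonNeumannAlgebra K} (J : H →ₗᵢ[ℂ] K) {y : K →L[ℂ] K}
    (hy : ∀ r ∈ R, ∀ h : H, y (r (J h)) ∈ cyclicSubspace R J) {x : K}
    (hx : x ∈ cyclicSubspace R J) : y x ∈ cyclicSubspace R J := by
  have hle : cyclicSubspace R J ≤ (cyclicSubspace R J).comap (y : K →ₗ[ℂ] K) := by
    refine Submodule.topologicalClosure_minimal _ (Submodule.span_le.mpr ?_) ?_
    · rintro _ ⟨r, hr, h, rfl⟩
      exact hy r hr h
    · exact (Submodule.isClosed_topologicalClosure _).preimage y.continuous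
  exact hle hx

theorem mem_cyclicSubspace {R : VonNeumannAlgebra K} (J : H →ₗᵢ[ℂ] K) {r : K →L[ℂ] K}
    (hr : r ∈ R) (h : H) : r (J h) ∈ cyclicSubspace R J :=
  Submodule.le_topologicalClosure _ (Submodule.subset_span ⟨r, hr, h, rfl⟩)

/-- A projection lies in `N = N''` as soon as its range is invariant under `N'`. Used for both `N =
R` and `N = R'`, which makes the projection central. -/
theorem starProjection_cyclicSubspace_mem {R : VonNeumannAlgebra K} (J : H →ₗᵢ[ℂ] K)
    (N : VonNeumannAlgebra K)
    (hN : ∀ y ∈ N.commutant, ∀ r ∈ R, ∀ h : H, y (r (J h)) ∈ cyclicSubspace R J) :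
    (cyclicSubspace R J).starProjection ∈ N := by
  rw [IsStarProjection.mem_iff isStarProjection_starProjection]
  intro y hy
  rw [Submodule.range_starProjection, Module.End.mem_invtSubmodule]
  intro x hx
  exact apply_mem_cyclicSubspace J (hN y hy) hx

variable [CompleteSpace H]

theorem corner_apply (J : H →ₗᵢ[ℂ] K) (a : H →L[ℂ] H) (x : K) :
    corner J a x = J (a (ContinuousLinearMap.adjoint J.toContinuousLinearMap x)) := rfl

theorem compress_apply (J : H →ₗᵢ[ℂ] K) (T : K →L[ℂ] K) (x : H) :
    compress J T x = ContinuousLinearMap.adjoint J.toContinuousLinearMap (T (J x)) := rfl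

theorem adjoint_apply_self (J : H →ₗᵢ[ℂ] K) (x : H) :
    ContinuousLinearMap.adjoint J.toContinuousLinearMap (J x) = x :=
  ext_inner_left ℂ fun y => by
    rw [ContinuousLinearMap.adjoint_inner_right]; exact J.inner_map_map y x

theorem isStarProjection_corner_one (J : H →ₗᵢ[ℂ] K) : IsStarProjection (corner J 1) := by
  constructor
  · ext x
    simp [corner_apply, adjoint_apply_self]
  · rw [ContinuousLinearMap.isSelfAdjoint_iff']
    simp [corner, ContinuousLinearMap.adjoint_comp, ContinuousLinearMap.one_def]

/-- Commuting with `P_H` makes `y` leave `J(H)` invariant; commuting with the whole corner makes its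
restriction commute with `B(H)`. -/
theorem apply_eq_of_mem_commutant {R : VonNeumannAlgebra K} {J : H →ₗᵢ[ℂ] K}
    (hR : ∀ a, corner J a ∈ R) {y : K →L[ℂ] K} (hy : y ∈ R.commutant) (a : H →L[ℂ] H) (h : H) :
    y (J (a h)) = J (a (compress J y h)) := by
  have := DFunLike.congr_fun (mem_commutant_iff.mp hy _ (hR a)) (J h)
  simpa [corner_apply, adjoint_apply_self, compress_apply] using this.symm

theorem apply_apply_of_mem_commutant {R : VonNeumannAlgebra K} {r y : K →L[ℂ] K} (hr : r ∈ R)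
    (hy : y ∈ R.commutant) (x : K) : y (r x) = r (y x) :=
  (DFunLike.congr_fun (mem_commutant_iff.mp hy r hr) x).symm

theorem cyclicSubspace_eq_top {R : VonNeumannAlgebra K} {J : H →ₗᵢ[ℂ] K}
    (hR : ∀ a, corner J a ∈ R) (h : R.IsCentralSupport (corner J 1) 1) :
    cyclicSubspace R J = ⊤ := by
  obtain ⟨_, hp⟩ := isStarProjection_iff_eq_starProjection_range.mp (isStarProjection_corner_one J)
  have hle : (1 : K →L[ℂ] K) ≤ (cyclicSubspace R J).starProjection := by
    refine h.2 ⟨isStarProjection_starProjection, ?_, ?_, ?_⟩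
    · refine starProjection_cyclicSubspace_mem J R fun y hy r hr h => ?_
      have hyh := apply_eq_of_mem_commutant hR hy 1 h
      rw [one_apply_eq_self, one_apply_eq_self] at hyh
      rw [apply_apply_of_mem_commutant hr hy, hyh]
      exact mem_cyclicSubspace J hr _
    · refine starProjection_cyclicSubspace_mem J R.commutant fun y hy r hr h => ?_
      rw [commutant_commutant] at hy
      exact mem_cyclicSubspace J (mul_mem hy hr) h
    · rw [hp, Submodule.starProjection_le_starProjection_iff]
      rintro _ ⟨x, rfl⟩
      exact mem_cyclicSubspace J (one_mem R) _
  rw [← Submodule.starProjection_top', Submodule.starProjection_le_starProjection_iff] at hle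
  exact top_le_iff.mp hle

/-- A von Neumann algebra with a corner `B(H)` of central support `1` is a type I factor that acts
irreducibly. -/
theorem eq_allOperators_of_isCentralSupport {R : VonNeumannAlgebra K} {J : H →ₗᵢ[ℂ] K}
    (hR : ∀ a, corner J a ∈ R) (h : R.IsCentralSupport (corner J 1) 1) {e : H} (he : ‖e‖ = 1) :
    R = allOperators K := by
  refine eq_allOperators_of_commutant_subset_scalars fun y hy => ?_
  refine ⟨inner ℂ e (compress J y e), ?_⟩
  set c := inner ℂ e (compress J y e) with hc
  have hJ (x : H) : y (J x) = c • J x := by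
    -- The rank-one operator `|x⟩⟨e|` carries the value at `e` to every `x`, so one scalar serves
    -- all of `J(H)`.
    have := apply_eq_of_mem_commutant hR hy (InnerProductSpace.rankOne ℂ x e) e
    simpa [he, ← hc] using this
  have hle : cyclicSubspace R J ≤
      LinearMap.eqLocus (y : K →ₗ[ℂ] K) ((c • 1 : K →L[ℂ] K) : K →ₗ[ℂ] K) := by
    refine Submodule.topologicalClosure_minimal _ (Submodule.span_le.mpr ?_)
      (isClosed_eq y.continuous (c • 1 : K →L[ℂ] K).continuous)
    rintro _ ⟨r, hr, x, rfl⟩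
    simp [apply_apply_of_mem_commutant hr hy, hJ]
  ext x
  exact hle (cyclicSubspace_eq_top hR h ▸ Submodule.mem_top)

end Factor

end VonNeumannAlgebra

/-! ### From endomorphisms of `B(K)` to commuting isometries -/

section Dilation

open VonNeumannAlgebra InnerProductSpace

variable {S : Type*} [AddMonoid S]
variable {H : Type*} [NormedAddCommGroup H] [InnerProductSpace ℂ H] [CompleteSpace H]
variable {K : Type*} [NormedAddCommGroup K] [InnerProductSpace ℂ K] [CompleteSpace K]
variable {Θ : S → (allOperators H →CP allOperators H)} {J : H →ₗᵢ[ℂ] K}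
variable {α : S → (allOperators K →CP allOperators K)} {V : S → (H →L[ℂ] H)} {e : H}

/-- The operators `x ↦ α_s(|x⟩⟨Je|) Je` associated with an e-semigroup `α` on `B(K)`. -/
noncomputable def intertwiner (α : S → (allOperators K →CP allOperators K)) (J : H →ₗᵢ[ℂ] K)
    (e : H) (s : S) : K →ₗ[ℂ] K where
  toFun x := (α s (toAllOperators (rankOne ℂ x (J e))) : K →L[ℂ] K) (J e)
  map_add' x y := by
    have : toAllOperators (rankOne ℂ (x + y) (J e)) =
        toAllOperators (rankOne ℂ x (J e)) + toAllOperators (rankOne ℂ y (J e)) :=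
      Subtype.ext (by simp)
    rw [this, map_add]; rfl
  map_smul' c x := by
    have : toAllOperators (rankOne ℂ (c • x) (J e)) =
        c • toAllOperators (rankOne ℂ x (J e)) := Subtype.ext (by simp)
    rw [this, map_smul]; rfl

omit [AddMonoid S] [CompleteSpace H] in
theorem intertwiner_apply (s : S) (x : K) : intertwiner α J e s x =
    (α s (toAllOperators (rankOne ℂ x (J e))) : K →L[ℂ] K) (J e) := rfl

omit [CompleteSpace H] in
theorem apply_intertwiner (h : IsESemigroup α) (s : S) (a : K →L[ℂ] K) (x : K) :
    (α s (toAllOperators a) : K →L[ℂ] K) (intertwiner α J e s x) =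
      intertwiner α J e s (a x) := by
  have : toAllOperators (rankOne ℂ (a x) (J e)) =
      toAllOperators a * toAllOperators (rankOne ℂ x (J e)) := Subtype.ext (by
    simp [ContinuousLinearMap.mul_def, comp_rankOne])
  rw [intertwiner_apply, intertwiner_apply, this, h.map_mul]
  rfl

/-- The compression of `|x⟩⟨Je|` is `|J*x⟩⟨e|`; the dilation identity is evaluated at `e`, where
`V_s* e = e`. -/
theorem adjoint_intertwiner (hV : ∀ s a, (Θ s a : H →L[ℂ] H) = V s * a * star (V s))
    (h : IsEDilation Θ J (allOperators K) α) (he : ‖e‖ = 1) (hfix : ∀ s, star (V s) e = e)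
    (s : S) (x : K) :
    ContinuousLinearMap.adjoint J.toContinuousLinearMap (intertwiner α J e s x) =
      V s (ContinuousLinearMap.adjoint J.toContinuousLinearMap x) := by
  have := DFunLike.congr_fun (h.dilation s (toAllOperators (rankOne ℂ x (J e)))) e
  rw [hV, compress_apply, ← intertwiner_apply] at this
  rw [← this]
  simp [hfix, compress_apply, he]

theorem inner_intertwiner (hV : ∀ s a, (Θ s a : H →L[ℂ] H) = V s * a * star (V s))
    (h : IsEDilation Θ J (allOperators K) α) (he : ‖e‖ = 1) (hfix : ∀ s, star (V s) e = e)
    (s : S) (x : H) (y : K) : inner ℂ (J x) (intertwiner α J e s y) =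
      inner ℂ (star (V s) x) (ContinuousLinearMap.adjoint J.toContinuousLinearMap y) := by
  rw [ContinuousLinearMap.star_eq_adjoint, ContinuousLinearMap.adjoint_inner_left,
    ← adjoint_intertwiner hV h he hfix, ContinuousLinearMap.adjoint_inner_right]
  rfl

/-- From `|x⟩⟨Je|* |x⟩⟨Je| = ‖x‖² |Je⟩⟨Je|` and multiplicativity, `‖W_s x‖² = ‖x‖² ⟪Je, W_s Je⟫`,
and the last factor is `⟪V_s* e, e⟫ = 1`. -/
theorem norm_intertwiner (hV : ∀ s a, (Θ s a : H →L[ℂ] H) = V s * a * star (V s))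
    (h : IsEDilation Θ J (allOperators K) α) (he : ‖e‖ = 1) (hfix : ∀ s, star (V s) e = e)
    (s : S) (x : K) : ‖intertwiner α J e s x‖ = ‖x‖ := by
  have h1 : star (toAllOperators (rankOne ℂ x (J e))) * toAllOperators (rankOne ℂ x (J e)) =
      inner ℂ x x • toAllOperators (rankOne ℂ (J e) (J e)) := Subtype.ext (by
    simp [ContinuousLinearMap.star_eq_adjoint, ContinuousLinearMap.mul_def, rankOne_comp_rankOne])
  have h2 := h.isESemigroup.map_mul s (star (toAllOperators (rankOne ℂ x (J e))))
    (toAllOperators (rankOne ℂ x (J e)))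
  rw [h1, map_smul, h.isESemigroup.map_star] at h2
  have h3 : inner ℂ (intertwiner α J e s x) (intertwiner α J e s x) = inner ℂ x x := by
    have h4 := congrArg (fun a : allOperators K => inner ℂ (J e) ((a : K →L[ℂ] K) (J e))) h2
    have h5 : inner ℂ x x * inner ℂ (J e) (intertwiner α J e s (J e)) =
        inner ℂ (intertwiner α J e s x) (intertwiner α J e s x) := by
      simpa [ContinuousLinearMap.star_eq_adjoint, ContinuousLinearMap.adjoint_inner_right,
        inner_smul_right, ← intertwiner_apply] using h4
    rw [← h5, inner_intertwiner hV h he hfix, adjoint_apply_self, hfix]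
    simp [he]
  rw [inner_self_eq_norm_sq_to_K, inner_self_eq_norm_sq_to_K] at h3
  exact (sq_eq_sq₀ (norm_nonneg _) (norm_nonneg _)).mp (by exact_mod_cast h3)

/-- Equality case of Cauchy–Schwarz: two unit vectors with inner product `1` coincide. -/
theorem intertwiner_apply_self (hV : ∀ s a, (Θ s a : H →L[ℂ] H) = V s * a * star (V s))
    (h : IsEDilation Θ J (allOperators K) α) (he : ‖e‖ = 1) (hfix : ∀ s, star (V s) e = e)
    (s : S) : intertwiner α J e s (J e) = J e := by
  refine ((inner_eq_one_iff_of_norm_eq_one (𝕜 := ℂ) ?_ ?_).mp ?_).symm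
  · rw [J.norm_map, he]
  · rw [norm_intertwiner hV h he hfix, J.norm_map, he]
  · rw [inner_intertwiner hV h he hfix, adjoint_apply_self, hfix]
    simp [he]

/-- As `Je` is fixed by `W_s`, `W_s α_t(|x⟩⟨Je|) Je = α_s(α_t(|x⟩⟨Je|)) W_s Je = α_{s+t}(|x⟩⟨Je|)
Je`. -/
theorem intertwiner_intertwiner (hV : ∀ s a, (Θ s a : H →L[ℂ] H) = V s * a * star (V s))
    (h : IsEDilation Θ J (allOperators K) α) (he : ‖e‖ = 1) (hfix : ∀ s, star (V s) e = e)
    (s t : S) (x : K) :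
    intertwiner α J e s (intertwiner α J e t x) = intertwiner α J e (s + t) x := by
  conv_lhs => rw [intertwiner_apply t]
  rw [← apply_intertwiner h.isESemigroup, intertwiner_apply_self hV h he hfix,
    intertwiner_apply, h.isESemigroup.map_add]
  rfl

/-- On vectors on which `V_s` is isometric, the intertwiner extends `V_s`. -/
theorem intertwiner_apply_of_star_apply
    (hV : ∀ s a, (Θ s a : H →L[ℂ] H) = V s * a * star (V s))
    (h : IsEDilation Θ J (allOperators K) α) (he : ‖e‖ = 1) (hfix : ∀ s, star (V s) e = e)
    {s : S} {x y : H} (hx : ‖x‖ = 1) (hy : ‖y‖ = 1) (hxy : star (V s) y = x) :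
    intertwiner α J e s (J x) = J y := by
  refine ((inner_eq_one_iff_of_norm_eq_one (𝕜 := ℂ) ?_ ?_).mp ?_).symm
  · rw [J.norm_map, hy]
  · rw [norm_intertwiner hV h he hfix, J.norm_map, hx]
  · rw [inner_intertwiner hV h he hfix, adjoint_apply_self, hxy]
    simp [hx]

end Dilation

/-! ### Semigroups generated by three commuting operators -/

section Triple

/-- The product `T₀ ^ n₀ * T₁ ^ n₁ * T₂ ^ n₂`. -/
def triplePow {A : Type*} [Monoid A] (T : Fin 3 → A) (n : Fin 3 → ℕ) : A :=
  T 0 ^ n 0 * T 1 ^ n 1 * T 2 ^ n 2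

variable {A : Type*} [Monoid A] {T : Fin 3 → A}

theorem triplePow_zero (T : Fin 3 → A) : triplePow T 0 = 1 := by simp [triplePow]

theorem triplePow_single (T : Fin 3 → A) (i : Fin 3) : triplePow T (Pi.single i 1) = T i := by
  fin_cases i <;> simp [triplePow]

theorem triplePow_add (hT : ∀ i j, Commute (T i) (T j)) (m n : Fin 3 → ℕ) :
    triplePow T (m + n) = triplePow T m * triplePow T n := by
  have h10 := ((hT 1 0).pow_pow (m 1) (n 0)).eq
  have h20 := ((hT 2 0).pow_pow (m 2) (n 0)).eq
  have h21 := ((hT 2 1).pow_pow (m 2) (n 1)).eq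
  simp only [triplePow, Pi.add_apply, pow_add]
  calc T 0 ^ m 0 * T 0 ^ n 0 * (T 1 ^ m 1 * T 1 ^ n 1) * (T 2 ^ m 2 * T 2 ^ n 2)
      = T 0 ^ m 0 * (T 0 ^ n 0 * T 1 ^ m 1) * (T 1 ^ n 1 * T 2 ^ m 2) * T 2 ^ n 2 := by
        simp only [mul_assoc]
    _ = T 0 ^ m 0 * T 1 ^ m 1 * (T 0 ^ n 0 * T 2 ^ m 2) * T 1 ^ n 1 * T 2 ^ n 2 := by
        rw [← h10, ← h21]; simp only [mul_assoc]
    _ = T 0 ^ m 0 * T 1 ^ m 1 * T 2 ^ m 2 * (T 0 ^ n 0 * T 1 ^ n 1 * T 2 ^ n 2) := by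
        rw [← h20]; simp only [mul_assoc]

theorem norm_triplePow_le {A : Type*} [NormedRing A] [NormOneClass A] {T : Fin 3 → A}
    (hT : ∀ i, ‖T i‖ ≤ 1) (n : Fin 3 → ℕ) : ‖triplePow T n‖ ≤ 1 := by
  have h (i : Fin 3) : ‖T i ^ n i‖ ≤ 1 :=
    (norm_pow_le _ _).trans (pow_le_one₀ (norm_nonneg _) (hT i))
  exact (norm_mul₃_le ..).trans
    (mul_le_one₀ (mul_le_one₀ (h 0) (norm_nonneg _) (h 1)) (norm_nonneg _) (h 2))

variable {H : Type*} [NormedAddCommGroup H] [InnerProductSpace ℂ H] [CompleteSpace H]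

theorem star_triplePow_apply_eq_self {T : Fin 3 → (H →L[ℂ] H)} {e : H}
    (he : ∀ i, star (T i) e = e) (n : Fin 3 → ℕ) : star (triplePow T n) e = e := by
  have h (i : Fin 3) (k : ℕ) : (star (T i) ^ k) e = e := by
    induction k with
    | zero => simp
    | succ k ih => rw [pow_succ, mul_apply_eq_comp, he, ih]
  simp [triplePow, star_mul, star_pow, h]

theorem isCPSemigroup_conjugation_triplePow {T : Fin 3 → (H →L[ℂ] H)}
    (hT : ∀ i j, Commute (T i) (T j)) (hn : ∀ n, ‖triplePow T n‖ ≤ 1) :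
    IsCPSemigroup fun n => VonNeumannAlgebra.conjugation (triplePow T n) where
  contractive n := VonNeumannAlgebra.norm_conjugation_apply_le (hn n)
  normal n := VonNeumannAlgebra.isNormalMap_conjugation _
  map_zero a := Subtype.ext (by simp [triplePow_zero])
  map_add m n a := Subtype.ext (by simp [triplePow_add hT, mul_assoc])

end Triple

/-! ### Parrott's example -/

section Parrott

/-- The matrices of Parrott's three commuting contractions, each enlarged by the direct summand
`1`. -/
def parrottMatrix : Fin 3 → Matrix (Fin 5) (Fin 5) ℂ :=
  ![!![0, 0, 0, 0, 0; 0, 0, 0, 0, 0; 1, 0, 0, 0, 0; 0, 1, 0, 0, 0; 0, 0, 0, 0, 1],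
    !![0, 0, 0, 0, 0; 0, 0, 0, 0, 0; 1, 0, 0, 0, 0; 0, -1, 0, 0, 0; 0, 0, 0, 0, 1],
    !![0, 0, 0, 0, 0; 0, 0, 0, 0, 0; 0, 1, 0, 0, 0; 1, 0, 0, 0, 0; 0, 0, 0, 0, 1]]

theorem parrottMatrix_mul (i j : Fin 3) :
    parrottMatrix i * parrottMatrix j = Matrix.diagonal ![0, 0, 0, 0, 1] := by
  ext k l
  fin_cases i <;> fin_cases j <;> fin_cases k <;> fin_cases l <;>
    simp [parrottMatrix, Matrix.mul_apply, Fin.sum_univ_five]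

theorem star_parrottMatrix_mul_self (i : Fin 3) :
    star (parrottMatrix i) * parrottMatrix i = Matrix.diagonal ![1, 1, 0, 0, 1] := by
  ext k l
  fin_cases i <;> fin_cases k <;> fin_cases l <;>
    simp [parrottMatrix, Matrix.mul_apply, Fin.sum_univ_five]

/-- The operators with the matrices `parrottMatrix`. -/
noncomputable def parrott (i : Fin 3) : EuclideanSpace ℂ (Fin 5) →L[ℂ] EuclideanSpace ℂ (Fin 5) :=
  Matrix.toEuclideanCLM (n := Fin 5) (𝕜 := ℂ) (parrottMatrix i)

theorem commute_parrott (i j : Fin 3) : Commute (parrott i) (parrott j) := by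
  rw [Commute, SemiconjBy, parrott, parrott, ← map_mul, ← map_mul, parrottMatrix_mul,
    parrottMatrix_mul]

theorem norm_parrott_le (i : Fin 3) : ‖parrott i‖ ≤ 1 := by
  have hd : star (Matrix.diagonal ![1, 1, 0, 0, 1] : Matrix (Fin 5) (Fin 5) ℂ) =
      Matrix.diagonal ![1, 1, 0, 0, 1] := by
    rw [Matrix.star_eq_conjTranspose, Matrix.diagonal_conjTranspose]
    congr 1; ext k; fin_cases k <;> simp
  have hdd : (Matrix.diagonal ![1, 1, 0, 0, 1] : Matrix (Fin 5) (Fin 5) ℂ) *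
      Matrix.diagonal ![1, 1, 0, 0, 1] = Matrix.diagonal ![1, 1, 0, 0, 1] := by
    rw [Matrix.diagonal_mul_diagonal]
    congr 1; ext k; fin_cases k <;> simp
  -- Each operator is a partial isometry.
  have h : IsStarProjection (star (parrott i) * parrott i) := by
    rw [parrott, ← map_star, ← map_mul, star_parrottMatrix_mul_self]
    exact ⟨by rw [IsIdempotentElem, ← map_mul, hdd],
      by rw [IsSelfAdjoint, ← map_star, hd]⟩
  have hle : ‖parrott i‖ * ‖parrott i‖ ≤ 1 :=
    CStarRing.norm_star_mul_self (x := parrott i) ▸ IsStarProjection.norm_le _ h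
  nlinarith [norm_nonneg (parrott i)]

theorem star_parrott_single (i : Fin 3) (k : Fin 5) :
    star (parrott i) (EuclideanSpace.single k 1) =
      WithLp.toLp 2 fun l => star (parrottMatrix i k l) := by
  rw [parrott, ← map_star]
  ext l
  simp [Matrix.ofLp_toEuclideanCLM, Matrix.star_eq_conjTranspose]

theorem star_parrott_single_four (i : Fin 3) :
    star (parrott i) (EuclideanSpace.single 4 1) = EuclideanSpace.single 4 1 := by
  rw [star_parrott_single]
  ext l
  fin_cases i <;> fin_cases l <;> simp [parrottMatrix]

open VonNeumannAlgebra in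
theorem not_isEDilation_parrott {K : Type*} [NormedAddCommGroup K] [InnerProductSpace ℂ K]
    [CompleteSpace K] (J : EuclideanSpace ℂ (Fin 5) →ₗᵢ[ℂ] K)
    (α : (Fin 3 → ℕ) → (allOperators K →CP allOperators K)) :
    ¬ IsEDilation (fun n => conjugation (triplePow parrott n)) J (allOperators K) α := by
  intro h
  let f (k : Fin 5) : EuclideanSpace ℂ (Fin 5) := EuclideanSpace.single k 1
  have hf (k : Fin 5) : ‖f k‖ = 1 := by simp [f]
  have hV : ∀ (n : Fin 3 → ℕ) (a : allOperators (EuclideanSpace ℂ (Fin 5))),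
      (conjugation (triplePow parrott n) a : EuclideanSpace ℂ (Fin 5) →L[ℂ] _) =
        triplePow parrott n * (a : EuclideanSpace ℂ (Fin 5) →L[ℂ] _) *
          star (triplePow parrott n) := fun _ _ => rfl
  have hfix := star_triplePow_apply_eq_self star_parrott_single_four
  let W (i : Fin 3) : K →ₗ[ℂ] K := intertwiner α J (f 4) (Pi.single i 1)
  have hcomm (i j : Fin 3) (x : K) : W i (W j x) = W j (W i x) := by
    simp only [W]
    rw [intertwiner_intertwiner hV h (hf 4) hfix, intertwiner_intertwiner hV h (hf 4) hfix,
      add_comm]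
  have hnorm (i : Fin 3) (x : K) : ‖W i x‖ = ‖x‖ := norm_intertwiner hV h (hf 4) hfix _ x
  have hW {i : Fin 3} {x y : EuclideanSpace ℂ (Fin 5)} (hx : ‖x‖ = 1) (hy : ‖y‖ = 1)
      (hxy : star (parrott i) y = x) : W i (J x) = J y :=
    intertwiner_apply_of_star_apply hV h (hf 4) hfix hx hy (by rwa [triplePow_single])
  have h00 : W 0 (J (f 0)) = J (f 2) := hW (hf 0) (hf 2) (by
    rw [star_parrott_single]; ext l; fin_cases l <;> simp [parrottMatrix, f])
  have h01 : W 0 (J (f 1)) = J (f 3) := hW (hf 1) (hf 3) (by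
    rw [star_parrott_single]; ext l; fin_cases l <;> simp [parrottMatrix, f])
  have h10 : W 1 (J (f 0)) = J (f 2) := hW (hf 0) (hf 2) (by
    rw [star_parrott_single]; ext l; fin_cases l <;> simp [parrottMatrix, f])
  have h11 : W 1 (J (f 1)) = -J (f 3) := by
    rw [← map_neg]
    refine hW (hf 1) (by rw [norm_neg, hf]) ?_
    rw [map_neg, star_parrott_single]; ext l; fin_cases l <;> simp [parrottMatrix, f]
  have h20 : W 2 (J (f 0)) = J (f 3) := hW (hf 0) (hf 3) (by
    rw [star_parrott_single]; ext l; fin_cases l <;> simp [parrottMatrix, f])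
  -- Commuting past `W 0` evaluates `W 1 W 2` and `W 2 W 1` at `J (f 0)` with opposite signs, so `W
  -- 0` would annihilate the unit vector `J (f 3)`.
  have e1 : W 1 (W 2 (J (f 0))) = -W 0 (J (f 3)) := by
    rw [h20, ← h01, hcomm 1 0, h11, map_neg, h01]
  have e2 : W 2 (W 1 (J (f 0))) = W 0 (J (f 3)) := by
    rw [h10, ← h00, hcomm 2 0, h20]
  rw [hcomm, e2, eq_neg_iff_add_eq_zero, ← two_smul ℂ] at e1
  have := hnorm 0 (J (f 3))
  rw [(smul_eq_zero_iff_right two_ne_zero).mp e1, J.norm_map, hf, norm_zero] at this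
  exact zero_ne_one this

end Parrott

theorem mainTheorem4 :
    ∃ (H : Type) (_ : NormedAddCommGroup H) (_ : InnerProductSpace ℂ H) (_ : CompleteSpace H)
      (T : Fin 3 → (H →L[ℂ] H))
      (Θ : (Fin 3 → ℕ) →
        (VonNeumannAlgebra.allOperators H →CP VonNeumannAlgebra.allOperators H)),
      -- `T₀, T₁, T₂` are commuting contractions
      (∀ i j, Commute (T i) (T j)) ∧ (∀ i, ‖T i‖ ≤ 1) ∧
      -- `Θ` is the semigroup generated by the maps `a ↦ Tᵢ a Tᵢ*`
      (∀ (n : Fin 3 → ℕ) (a : VonNeumannAlgebra.allOperators H),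
        (Θ n a : H →L[ℂ] H) =
          (T 0 ^ n 0 * T 1 ^ n 1 * T 2 ^ n 2) * (a : H →L[ℂ] H) *
            star (T 0 ^ n 0 * T 1 ^ n 1 * T 2 ^ n 2)) ∧
      IsCPSemigroup Θ ∧
      -- there is no e-dilation on any `B(K)`
      (∀ (K : Type*) [NormedAddCommGroup K] [InnerProductSpace ℂ K] [CompleteSpace K]
        (J : H →ₗᵢ[ℂ] K)
        (α : (Fin 3 → ℕ) →
          (VonNeumannAlgebra.allOperators K →CP VonNeumannAlgebra.allOperators K)),
        ¬ IsEDilation Θ J (VonNeumannAlgebra.allOperators K) α) ∧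
      -- there is no minimal e-dilation on any von Neumann algebra
      (∀ (K : Type*) [NormedAddCommGroup K] [InnerProductSpace ℂ K] [CompleteSpace K]
        (J : H →ₗᵢ[ℂ] K) (R : VonNeumannAlgebra K) (α : (Fin 3 → ℕ) → (R →CP R)),
        ¬ IsMinimalEDilation Θ J R α) := by
  refine ⟨EuclideanSpace ℂ (Fin 5), inferInstance, inferInstance, inferInstance, parrott,
    fun n => VonNeumannAlgebra.conjugation (triplePow parrott n), commute_parrott, norm_parrott_le,
    fun n a => rfl, isCPSemigroup_conjugation_triplePow commute_parrott
      (norm_triplePow_le norm_parrott_le), ?_, ?_⟩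
  · intro K _ _ _ J α
    exact not_isEDilation_parrott J α
  · intro K _ _ _ J R α h
    obtain rfl := VonNeumannAlgebra.eq_allOperators_of_isCentralSupport
      (fun a => h.corner_mem a (VonNeumannAlgebra.mem_allOperators a)) h.centralSupport
      (e := EuclideanSpace.single 0 1) (by simp)
    exact not_isEDilation_parrott J α h.toIsEDilation
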